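/- All graphs are finite and simple. A set $S$ of vertices of a graph $G$ is a dissociation set if the induced subgraph $G[S]$ has maximum degree at most $1$; the dissociation number of $G$ is the maximum cardinality of a dissociation set of $G$. The spectral radius of $G$ is the largest eigenvalue of its adjacency matrix. Theorem. Let $n$ and $k$ be positive integers with $k>\lceil 2n/3\rceil$. If a graph $G$ attains the minimum spectral radius among all connected graphs of order $n$ with dissociation number $k$, then $G$ is a tree. -/

import Mathlib

/-- A set `S` of vertices is a dissociation set of `G` if the subgraph of `G` induced by `S`
has maximum degree at most one. -/
def IsDissociationSet {V : Type*} (G : SimpleGraph V) (S : Finset V) : Prop :=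
  open Classical in (G.induce (S : Set V)).maxDegree ≤ 1

/-- The dissociation number of a finite graph: the maximum cardinality of a dissociation set
(the empty set is one, so the maximum is over a nonempty finite family). -/
noncomputable def dissociationNumber {V : Type*} [Fintype V] (G : SimpleGraph V) : ℕ :=
  open Classical in ({S : Finset V | IsDissociationSet G S} : Finset (Finset V)).sup Finset.card

/-- The spectral radius of a finite graph: the largest eigenvalue of its adjacency matrix.
For a graph with at least one vertex the supremum is attained, see `isGreatest_graphSpectralRadius`. -/
noncomputable def graphSpectralRadius {V : Type*} [Fintype V] (G : SimpleGraph V) : ℝ :=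
  open Classical in sSup {μ : ℝ | Module.End.HasEigenvalue (G.adjMatrix ℝ).mulVecLin μ}

open Classical in
theorem isGreatest_graphSpectralRadius {V : Type*} [Fintype V] [Nonempty V] (G : SimpleGraph V) :
    IsGreatest {μ : ℝ | Module.End.HasEigenvalue (G.adjMatrix ℝ).mulVecLin μ}
      (graphSpectralRadius G) := by
  have hA : (G.adjMatrix ℝ).IsHermitian := by
    rw [Matrix.IsHermitian, Matrix.conjTranspose_eq_transpose_of_trivial]
    exact G.isSymm_adjMatrix
  have hset : {μ : ℝ | Module.End.HasEigenvalue (G.adjMatrix ℝ).mulVecLin μ}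
      = Set.range hA.eigenvalues := by
    rw [← hA.spectrum_real_eq_range_eigenvalues]
    ext μ
    rw [Set.mem_ofPred_eq, Module.End.hasEigenvalue_iff_mem_spectrum,
      ← Matrix.toLin'_apply', Matrix.spectrum_toLin']
  have hfin : (Set.range hA.eigenvalues).Finite := Set.finite_range _
  have hne : (Set.range hA.eigenvalues).Nonempty := Set.range_nonempty _
  have h := hne.csSup_mem hfin
  unfold graphSpectralRadius
  rw [hset]
  exact ⟨h, fun x hx => le_csSup hfin.bddAbove hx⟩

/-- `G` belongs to the class of connected graphs of order `n` with dissociation number `k`. -/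
def IsConnectedWithDissociation {V : Type*} [Fintype V] (n k : ℕ) (G : SimpleGraph V) : Prop :=
  Fintype.card V = n ∧ G.Connected ∧ dissociationNumber G = k

/-- `G` attains the minimum spectral radius among the connected graphs of order `n` with
dissociation number `k`. Every graph of order `n` is isomorphic to one on the vertex set of `G`,
so it is enough to let the competitors range over the graphs on that vertex set. -/
def AttainsMinSpectralRadius {V : Type*} [Fintype V] (n k : ℕ) (G : SimpleGraph V) : Prop :=
  IsConnectedWithDissociation n k G ∧
    ∀ H : SimpleGraph V, IsConnectedWithDissociation n k H →
      graphSpectralRadius G ≤ graphSpectralRadius H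

/-!
Let `G` be a minimizer that is not a tree and let `lam` be its spectral radius. As `G` has at least
as many edges as vertices, `2 ≤ lam`. Deleting edges lowers the spectral radius strictly, but may
raise the dissociation number. It therefore suffices to lower the dissociation number of a spanning
tree of `G` again, in steps of at most one and with the spectral radius staying below `lam`, until
it is `k`. This is possible because the tree can be deformed into a path, whose dissociation number
is at most `(2 n + 2) / 3 < k` (`three_mul_dissociationNumber_le`).

A step takes a vertex `u` with at least two children below which there are only chains, and
reattaches one of these chains to the end of another one. Only edges at a single vertex change, so
the dissociation number drops by at most one (`dissociationNumber_le_add_one`).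

Trees are given by parent functions, and the bound on the spectral radius is carried by a
`RatioCertificate`: the ratios `g v = y v / y (par v)` of a positive vector `y` satisfying
`A y ≤ lam • y`, strictly at the root. The certificate is local, which makes it easy to update under
a step: for `2 ≤ lam` the ratios on chains may be taken to be at most one, and there
`t ↦ (lam - t)⁻¹` does not expand distances (`inv_sub_le_add`), so hanging a branch of ratio `q` at
the end of a chain increases the ratio at its top by at most `q`, which is just what the old parent
of the branch saves (`RatioCertificate.exists_move`). The first certificate comes from the Perron
vector of `G` (`exists_ratioCertificate_of_not_isTree`).
-/

/-! ### Dissociation sets -/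

section DissociationSets

variable {V : Type*}

/-- A set is a dissociation set iff no vertex of it has two distinct neighbours in it. -/
theorem isDissociationSet_iff (G : SimpleGraph V) (S : Finset V) :
    IsDissociationSet G S ↔
      ∀ a ∈ S, ∀ b ∈ S, ∀ c ∈ S, G.Adj a b → G.Adj a c → b = c := by
  classical
  unfold IsDissociationSet
  constructor
  · intro h a ha b hb c hc hab hac
    have hdeg := (SimpleGraph.degree_le_maxDegree (G.induce (S : Set V)) ⟨a, ha⟩).trans h
    have := Finset.card_le_one.mp hdeg ⟨b, hb⟩ (by simpa using hab) ⟨c, hc⟩ (by simpa using hac)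
    simpa using this
  · intro h
    refine SimpleGraph.maxDegree_le_of_forall_degree_le _ _ fun v => ?_
    refine Finset.card_le_one.mpr fun b hb c hc => ?_
    exact Subtype.ext (h v v.2 b b.2 c c.2 (by simpa using hb) (by simpa using hc))

variable [Fintype V]

theorem IsDissociationSet.card_le {G : SimpleGraph V} {S : Finset V}
    (hS : IsDissociationSet G S) : S.card ≤ dissociationNumber G := by
  classical
  exact Finset.le_sup (f := Finset.card) (by simpa using hS)

theorem exists_isDissociationSet_card_eq (G : SimpleGraph V) :
    ∃ S : Finset V, IsDissociationSet G S ∧ S.card = dissociationNumber G := by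
  classical
  have hne : ({S : Finset V | IsDissociationSet G S} : Finset (Finset V)).Nonempty :=
    ⟨∅, by simp [isDissociationSet_iff]⟩
  obtain ⟨S, hS, h⟩ := Finset.exists_mem_eq_sup _ hne Finset.card
  exact ⟨S, by simpa using hS, h.symm⟩

theorem dissociationNumber_anti {G H : SimpleGraph V} (h : H ≤ G) :
    dissociationNumber G ≤ dissociationNumber H := by
  obtain ⟨S, hS, hc⟩ := exists_isDissociationSet_card_eq G
  rw [← hc]
  refine IsDissociationSet.card_le ?_
  rw [isDissociationSet_iff] at hS ⊢
  exact fun a ha b hb c hc hab hac => hS a ha b hb c hc (h hab) (h hac)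

/-- If every edge of `H` avoiding `w` is an edge of `G`, then the dissociation number
decreases by at most one from `G` to `H`: drop `w` from a maximum dissociation set of `G`. -/
theorem dissociationNumber_le_add_one {G H : SimpleGraph V} (w : V)
    (h : ∀ a b, a ≠ w → b ≠ w → H.Adj a b → G.Adj a b) :
    dissociationNumber G ≤ dissociationNumber H + 1 := by
  classical
  obtain ⟨S, hS, hc⟩ := exists_isDissociationSet_card_eq G
  have hS' : IsDissociationSet H (S.erase w) := by
    rw [isDissociationSet_iff] at hS ⊢
    simp only [Finset.mem_erase]
    exact fun a ha b hb c hc hab hac =>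
      hS a ha.2 b hb.2 c hc.2 (h a b ha.1 hb.1 hab) (h a c ha.1 hc.1 hac)
  have := hS'.card_le
  have := Finset.pred_card_le_card_erase (s := S) (a := w)
  omega

end DissociationSets

/-! ### The spectral radius and the Perron vector -/

section SpectralRadius

variable {V : Type*} [Fintype V] [Nonempty V]

open Classical in
theorem posSemidef_graphSpectralRadius_sub_adjMatrix (G : SimpleGraph V) :
    (graphSpectralRadius G • (1 : Matrix V V ℝ) - G.adjMatrix ℝ).PosSemidef := by
  have hA : (G.adjMatrix ℝ).IsHermitian := by
    rw [Matrix.IsHermitian, Matrix.conjTranspose_eq_transpose_of_trivial]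
    exact G.isSymm_adjMatrix
  have hM : (graphSpectralRadius G • (1 : Matrix V V ℝ) - G.adjMatrix ℝ).IsHermitian := by
    refine Matrix.IsHermitian.sub ?_ hA
    rw [Matrix.IsHermitian, Matrix.conjTranspose_eq_transpose_of_trivial]
    simp
  rw [hM.posSemidef_iff_eigenvalues_nonneg]
  intro i
  have hv := hM.mulVec_eigenvectorBasis i
  set v : V → ℝ := ⇑(hM.eigenvectorBasis i) with hvdef
  have hv0 : v ≠ 0 := by
    intro h0
    apply hM.eigenvectorBasis.orthonormal.ne_zero i
    ext j
    exact congrFun h0 j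
  have heig : Module.End.HasEigenvalue (G.adjMatrix ℝ).mulVecLin
      (graphSpectralRadius G - hM.eigenvalues i) := by
    refine Module.End.hasEigenvalue_of_hasEigenvector (x := v) ⟨?_, hv0⟩
    rw [Module.End.mem_eigenspace_iff, Matrix.mulVecLin_apply]
    rw [Matrix.sub_mulVec, Matrix.smul_mulVec, Matrix.one_mulVec] at hv
    rw [sub_smul, ← hv]
    simp
  have := (isGreatest_graphSpectralRadius G).2 heig
  simpa using this

open Classical in
/-- The Rayleigh quotient bound. -/
theorem dotProduct_adjMatrix_mulVec_le (G : SimpleGraph V) (x : V → ℝ) :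
    x ⬝ᵥ (G.adjMatrix ℝ).mulVec x ≤ graphSpectralRadius G * (x ⬝ᵥ x) := by
  have := (posSemidef_graphSpectralRadius_sub_adjMatrix G).dotProduct_mulVec_nonneg x
  simp only [star_trivial, Matrix.sub_mulVec, Matrix.smul_mulVec, Matrix.one_mulVec,
    dotProduct_sub, dotProduct_smul, smul_eq_mul] at this
  linarith

open Classical in
theorem adjMatrix_mulVec_eq_of_rayleigh_eq {G : SimpleGraph V} {x : V → ℝ}
    (h : graphSpectralRadius G * (x ⬝ᵥ x) ≤ x ⬝ᵥ (G.adjMatrix ℝ).mulVec x) :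
    (G.adjMatrix ℝ).mulVec x = graphSpectralRadius G • x := by
  have h0 := ((posSemidef_graphSpectralRadius_sub_adjMatrix G).dotProduct_mulVec_zero_iff x).1 (by
    simp only [star_trivial, Matrix.sub_mulVec, Matrix.smul_mulVec, Matrix.one_mulVec,
      dotProduct_sub, dotProduct_smul, smul_eq_mul]
    linarith [dotProduct_adjMatrix_mulVec_le G x])
  simp only [Matrix.sub_mulVec, Matrix.smul_mulVec, Matrix.one_mulVec] at h0
  exact (sub_eq_zero.1 h0).symm

open Classical in
theorem exists_eigenvector_graphSpectralRadius (G : SimpleGraph V) :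
    ∃ x : V → ℝ, x ≠ 0 ∧ ∀ v, ∑ w ∈ G.neighborFinset v, x w = graphSpectralRadius G * x v := by
  obtain ⟨x, hx⟩ := (isGreatest_graphSpectralRadius G).1.exists_hasEigenvector
  refine ⟨x, hx.2, fun v => ?_⟩
  have := congrFun (Module.End.mem_eigenspace_iff.1 hx.1) v
  rw [Matrix.mulVecLin_apply, SimpleGraph.adjMatrix_mulVec_apply] at this
  simpa using this

open Classical in
/-- Perron's theorem: the spectral radius of a connected graph has a positive eigenvector. The
entrywise absolute value of an eigenvector maximizes the Rayleigh quotient, hence is one as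
well, and its zeros propagate along edges. -/
theorem SimpleGraph.Connected.exists_pos_eigenvector {G : SimpleGraph V} (hG : G.Connected) :
    ∃ x : V → ℝ, (∀ v, 0 < x v) ∧
      ∀ v, ∑ w ∈ G.neighborFinset v, x w = graphSpectralRadius G * x v := by
  obtain ⟨x, hx0, hx⟩ := exists_eigenvector_graphSpectralRadius G
  have key : (G.adjMatrix ℝ).mulVec (fun v => |x v|) = graphSpectralRadius G • fun v => |x v| := by
    apply adjMatrix_mulVec_eq_of_rayleigh_eq
    simp only [dotProduct, SimpleGraph.adjMatrix_mulVec_apply, Finset.mul_sum, abs_mul_abs_self]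
    refine Finset.sum_le_sum fun v _ => ?_
    calc graphSpectralRadius G * (x v * x v) = x v * ∑ w ∈ G.neighborFinset v, x w := by
          rw [hx]; ring
      _ ≤ |x v * ∑ w ∈ G.neighborFinset v, x w| := le_abs_self _
      _ ≤ |x v| * ∑ w ∈ G.neighborFinset v, |x w| := by
          rw [abs_mul]
          exact mul_le_mul_of_nonneg_left (Finset.abs_sum_le_sum_abs _ _) (abs_nonneg _)
      _ = _ := Finset.mul_sum _ _ _
  have hsum : ∀ v, ∑ w ∈ G.neighborFinset v, |x w| = graphSpectralRadius G * |x v| := fun v => by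
    simpa [SimpleGraph.adjMatrix_mulVec_apply] using congrFun key v
  refine ⟨fun v => |x v|, fun v => abs_pos.2 fun hv => hx0 ?_, hsum⟩
  have hstep : ∀ a b, G.Adj a b → x a = 0 → x b = 0 := by
    intro a b hab ha
    have h := hsum a
    rw [ha, abs_zero, mul_zero, Finset.sum_eq_zero_iff_of_nonneg fun _ _ => abs_nonneg _] at h
    exact abs_eq_zero.1 (h b (by simpa using hab))
  funext w
  obtain ⟨p⟩ := hG.preconnected v w
  induction p with
  | nil => exact hv
  | cons hab _ ih => exact ih (hstep _ _ hab hv)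

/-- The average degree of a connected graph that is not a tree is at least two. -/
theorem SimpleGraph.Connected.two_le_graphSpectralRadius {G : SimpleGraph V} (hG : G.Connected)
    (hT : ¬ G.IsTree) : 2 ≤ graphSpectralRadius G := by
  classical
  have hcard := hG.card_vert_le_card_edgeSet_add_one
  have hne : Nat.card G.edgeSet + 1 ≠ Nat.card V := fun h =>
    hT (SimpleGraph.isTree_iff_connected_and_card.2 ⟨hG, h⟩)
  have hle : Fintype.card V ≤ G.edgeFinset.card := by
    rw [← SimpleGraph.coe_edgeFinset, Nat.card_coe_set_eq, Set.ncard_coe_finset,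
      Nat.card_eq_fintype_card] at hcard hne
    omega
  have hdeg : (2 * Fintype.card V : ℝ) ≤ ∑ v, (G.degree v : ℝ) := by
    have := G.sum_degrees_eq_twice_card_edges
    exact_mod_cast (by omega : 2 * Fintype.card V ≤ ∑ v, G.degree v)
  have hR := dotProduct_adjMatrix_mulVec_le G fun _ => 1
  simp only [dotProduct, SimpleGraph.adjMatrix_mulVec_apply, Finset.sum_const, nsmul_eq_mul,
    mul_one, one_mul, SimpleGraph.card_neighborFinset_eq_degree, Finset.card_univ] at hR
  have hpos : (0 : ℝ) < Fintype.card V := by exact_mod_cast Fintype.card_pos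
  exact le_of_mul_le_mul_right (hdeg.trans hR) hpos

end SpectralRadius

/-! ### Trees given by parent functions -/

section ParentFunctions

variable {V : Type*}

/-- The graph with root `r` and parent function `par`: every vertex other than `r` is joined to
its parent. The value `par r` plays no role. -/
def parentGraph (par : V → V) (r : V) : SimpleGraph V :=
  SimpleGraph.fromRel fun a b => a ≠ r ∧ par a = b

/-- A rank function: it decreases from every non-root vertex to its parent. Its existence says
that iterating `par` leads every vertex to the root, so that `parentGraph par r` is a tree. Ranks
need not be depths. -/
def IsRank (par : V → V) (r : V) (d : V → ℕ) : Prop :=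
  ∀ v, v ≠ r → d (par v) < d v

theorem IsRank.par_ne {par : V → V} {r : V} {d : V → ℕ} (hd : IsRank par r d) {v : V}
    (hv : v ≠ r) : par v ≠ v := fun h => by
  have := hd v hv
  rw [h] at this
  exact lt_irrefl _ this

theorem IsRank.parentGraph_adj {par : V → V} {r : V} {d : V → ℕ} (hd : IsRank par r d) {a b : V} :
    (parentGraph par r).Adj a b ↔ (a ≠ r ∧ par a = b) ∨ (b ≠ r ∧ par b = a) := by
  rw [parentGraph, SimpleGraph.fromRel_adj, and_iff_right_iff_imp]
  rintro (⟨ha, rfl⟩ | ⟨hb, rfl⟩)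
  · exact (hd.par_ne ha).symm
  · exact hd.par_ne hb

theorem IsRank.connected {par : V → V} {r : V} {d : V → ℕ} (hd : IsRank par r d) :
    (parentGraph par r).Connected := by
  have key : ∀ n v, d v = n → (parentGraph par r).Reachable v r := by
    intro n
    induction n using Nat.strong_induction_on with
    | _ n ih =>
      intro v hv
      by_cases hr : v = r
      · rw [hr]
      · have hadj : (parentGraph par r).Adj v (par v) := hd.parentGraph_adj.2 (Or.inl ⟨hr, rfl⟩)
        exact hadj.reachable.trans (ih _ (hv ▸ hd v hr) _ rfl)
  have : Nonempty V := ⟨r⟩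
  exact ⟨fun v w => (key _ v rfl).trans (key _ w rfl).symm⟩

variable [Fintype V] [DecidableEq V]

/-- The children of `v` in the tree with root `r` and parent function `par`. -/
def childSet (par : V → V) (r v : V) : Finset V :=
  Finset.univ.filter fun c => c ≠ r ∧ par c = v

@[simp] theorem mem_childSet {par : V → V} {r v c : V} :
    c ∈ childSet par r v ↔ c ≠ r ∧ par c = v := by
  simp [childSet]

open Classical in
theorem IsRank.sum_neighborFinset {par : V → V} {r : V} {d : V → ℕ} (hd : IsRank par r d)
    (x : V → ℝ) (v : V) :
    ∑ w ∈ (parentGraph par r).neighborFinset v, x w =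
      ∑ c ∈ childSet par r v, x c + if v = r then 0 else x (par v) := by
  by_cases hv : v = r
  · rw [if_pos hv, add_zero]
    refine Finset.sum_congr ?_ fun _ _ => rfl
    ext w
    simp [hd.parentGraph_adj, hv]
  · rw [if_neg hv, add_comm, ← Finset.sum_insert (s := childSet par r v)]
    · refine Finset.sum_congr ?_ fun _ _ => rfl
      ext w
      simp [hd.parentGraph_adj, hv, eq_comm]
    · rw [mem_childSet]
      rintro ⟨h1, h2⟩
      have := hd v hv
      have := hd _ h1
      rw [h2] at this
      omega

theorem sum_childSet_comm {par : V → V} {r : V} (f : V → V → ℝ) :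
    ∑ v, ∑ c ∈ childSet par r v, f c v = ∑ c ∈ Finset.univ.erase r, f c (par c) := by
  rw [← Finset.sum_fiberwise_of_maps_to (s := Finset.univ.erase r) (t := Finset.univ) (g := par)
    (fun _ _ => Finset.mem_univ _)]
  refine Finset.sum_congr rfl fun v _ => ?_
  have : childSet par r v = (Finset.univ.erase r).filter fun c => par c = v := by ext; simp
  rw [← this]
  exact Finset.sum_congr rfl fun c hc => by rw [(mem_childSet.1 hc).2]

/-- A certificate that the spectral radius of the tree is less than `lam`. One should think of
`g v` as the ratio `y v / y (par v)` for a positive vector `y` with `A y ≤ lam • y`, the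
inequality being strict at the root; dividing it by `y v` gives the conditions below. The value
`g r` only has to be positive. -/
structure RatioCertificate (par : V → V) (r : V) (lam : ℝ) (g : V → ℝ) : Prop where
  pos : ∀ v, 0 < g v
  nonroot : ∀ v, v ≠ r → ∑ c ∈ childSet par r v, g c + (g v)⁻¹ ≤ lam
  root : ∑ c ∈ childSet par r r, g c < lam

/-- For an eigenvector `x` to the eigenvalue `μ`, `lam ≤ μ` would force all the nonnegative terms
`g v * (x v / g v - x (par v)) ^ 2` and the slack at the root to vanish, hence `x r = 0` and then
`x = 0`. -/
theorem RatioCertificate.graphSpectralRadius_lt {par : V → V} {r : V} {d : V → ℕ} {lam : ℝ}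
    {g : V → ℝ} (hd : IsRank par r d) (hg : RatioCertificate par r lam g) :
    graphSpectralRadius (parentGraph par r) < lam := by
  classical
  have : Nonempty V := ⟨r⟩
  obtain ⟨x, hx0, hx⟩ := exists_eigenvector_graphSpectralRadius (parentGraph par r)
  set μ := graphSpectralRadius (parentGraph par r)
  by_contra! hlam
  have hE : ∀ v, μ * x v ^ 2 =
      ∑ c ∈ childSet par r v, x c * x v + if v = r then 0 else x (par v) * x v := by
    intro v
    have := hx v
    rw [hd.sum_neighborFinset] at this
    rw [pow_two, ← mul_assoc, ← this, add_mul, Finset.sum_mul, ite_mul, zero_mul]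
  have hsum : ∑ v, μ * x v ^ 2 = ∑ v ∈ Finset.univ.erase r, 2 * (x v * x (par v)) := by
    rw [Finset.sum_congr rfl fun v _ => hE v, Finset.sum_add_distrib,
      sum_childSet_comm (fun c v => x c * x v),
      ← Finset.add_sum_erase _ (fun v => if v = r then 0 else x (par v) * x v)
        (Finset.mem_univ r), if_pos rfl, zero_add, ← Finset.sum_add_distrib]
    refine Finset.sum_congr rfl fun v hv => ?_
    rw [if_neg (Finset.ne_of_mem_erase hv)]
    ring
  have hS : ∑ v, ((∑ c ∈ childSet par r v, g c) + if v = r then 0 else (g v)⁻¹) * x v ^ 2 =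
      ∑ v ∈ Finset.univ.erase r, (g v * x (par v) ^ 2 + (g v)⁻¹ * x v ^ 2) := by
    simp_rw [add_mul, Finset.sum_mul]
    rw [Finset.sum_add_distrib, sum_childSet_comm (fun c v => g c * x v ^ 2),
      ← Finset.add_sum_erase _ (fun v => (if v = r then 0 else (g v)⁻¹) * x v ^ 2)
        (Finset.mem_univ r), if_pos rfl, zero_mul, zero_add, ← Finset.sum_add_distrib]
    refine Finset.sum_congr rfl fun v hv => ?_
    rw [if_neg (Finset.ne_of_mem_erase hv)]
  have hslack : ∀ v, 0 ≤
      (μ - ((∑ c ∈ childSet par r v, g c) + if v = r then 0 else (g v)⁻¹)) * x v ^ 2 := by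
    intro v
    refine mul_nonneg ?_ (sq_nonneg _)
    by_cases hv : v = r
    · subst hv
      have := hg.root
      simp only [if_true, add_zero]
      linarith
    · have := hg.nonroot v hv
      simp only [hv, if_false]
      linarith
  have hsq : ∀ v, g v * x (par v) ^ 2 + (g v)⁻¹ * x v ^ 2 - 2 * (x v * x (par v)) =
      g v * ((g v)⁻¹ * x v - x (par v)) ^ 2 := by
    intro v
    have := (hg.pos v).ne'
    field_simp
    ring
  have hsq0 : ∀ v, 0 ≤ g v * ((g v)⁻¹ * x v - x (par v)) ^ 2 := fun v =>
    mul_nonneg (hg.pos v).le (sq_nonneg _)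
  have htot : ∑ v, (μ - ((∑ c ∈ childSet par r v, g c) + if v = r then 0 else (g v)⁻¹)) * x v ^ 2 +
      ∑ v ∈ Finset.univ.erase r, g v * ((g v)⁻¹ * x v - x (par v)) ^ 2 = 0 := by
    simp_rw [← hsq, sub_mul]
    rw [Finset.sum_sub_distrib, Finset.sum_sub_distrib, hS, hsum]
    ring
  have h1 := Finset.sum_nonneg fun v (_ : v ∈ Finset.univ) => hslack v
  have h2 := Finset.sum_nonneg fun v (_ : v ∈ Finset.univ.erase r) => hsq0 v
  have hroot : x r = 0 := by
    have := (Finset.sum_eq_zero_iff_of_nonneg fun v _ => hslack v).1 (by linarith) r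
      (Finset.mem_univ r)
    simp only [if_true, add_zero] at this
    rcases mul_eq_zero.1 this with h | h
    · linarith [hg.root]
    · exact pow_eq_zero_iff two_ne_zero |>.1 h
  have hstep : ∀ v, v ≠ r → x (par v) = 0 → x v = 0 := by
    intro v hv hp
    have := (Finset.sum_eq_zero_iff_of_nonneg fun v _ => hsq0 v).1 (by linarith) v
      (Finset.mem_erase.2 ⟨hv, Finset.mem_univ v⟩)
    simpa [hp, (hg.pos v).ne'] using this
  have hall : ∀ n v, d v = n → x v = 0 := by
    intro n
    induction n using Nat.strong_induction_on with
    | _ n ih =>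
      intro v hv
      by_cases hr : v = r
      · rw [hr, hroot]
      · exact hstep v hr (ih _ (hv ▸ hd v hr) _ rfl)
  exact hx0 (funext fun v => hall _ v rfl)

/-- A connected graph that is not a tree contains a spanning tree, rooted at an end of an edge
not in the tree, for which the Perron vector of the graph provides a certificate. The edge missing
at the root makes the inequality there strict. -/
theorem exists_ratioCertificate_of_not_isTree {G : SimpleGraph V} (hG : G.Connected)
    (hT : ¬ G.IsTree) :
    ∃ (par : V → V) (r : V) (d : V → ℕ) (g : V → ℝ), IsRank par r d ∧
      RatioCertificate par r (graphSpectralRadius G) g ∧ parentGraph par r ≤ G := by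
  classical
  have hac : ¬ G.IsAcyclic := fun h => hT ⟨hG, h⟩
  rw [SimpleGraph.isAcyclic_iff_forall_adj_isBridge] at hac
  push Not at hac
  obtain ⟨r, b, hrb, hbr⟩ := hac
  have : Nonempty V := ⟨r⟩
  have hH := hG.connected_delete_edge_of_not_isBridge hbr
  set H := G.deleteEdges {s(r, b)} with hHdef
  have hex : ∀ v, ∃ w, v ≠ r → H.Adj v w ∧ H.dist w r < H.dist v r := by
    intro v
    by_cases hv : v = r
    · exact ⟨v, fun h => absurd hv h⟩
    obtain ⟨p, hp⟩ := hH.exists_walk_length_eq_dist v r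
    cases p with
    | nil => exact absurd rfl hv
    | @cons _ w _ hadj q =>
      refine ⟨w, fun _ => ⟨hadj, ?_⟩⟩
      have := SimpleGraph.dist_le q
      rw [SimpleGraph.Walk.length_cons] at hp
      omega
  choose par hpar using hex
  have hd : IsRank par r fun v => H.dist v r := fun v hv => (hpar v hv).2
  have hTH : parentGraph par r ≤ H := by
    intro u v huv
    rcases hd.parentGraph_adj.1 huv with ⟨h, rfl⟩ | ⟨h, rfl⟩
    · exact (hpar _ h).1
    · exact (hpar _ h).1.symm
  have hHG : H ≤ G := SimpleGraph.deleteEdges_le _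
  have hTG := hTH.trans hHG
  obtain ⟨x, hxpos, hx⟩ := hG.exists_pos_eigenvector
  have hle : ∀ v, ∑ c ∈ childSet par r v, x c + (if v = r then 0 else x (par v)) ≤
      graphSpectralRadius G * x v := by
    intro v
    rw [← hx, ← hd.sum_neighborFinset]
    refine Finset.sum_le_sum_of_subset_of_nonneg (fun w hw => ?_) fun w _ _ => (hxpos w).le
    rw [SimpleGraph.mem_neighborFinset] at hw ⊢
    exact hTG hw
  have hlt : ∑ c ∈ childSet par r r, x c < graphSpectralRadius G * x r := by
    have := hd.sum_neighborFinset x r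
    rw [if_pos rfl, add_zero] at this
    rw [← hx, ← this]
    refine Finset.sum_lt_sum_of_subset (i := b) (fun w hw => ?_) ?_ ?_ (hxpos b)
      fun w _ _ => (hxpos w).le
    · rw [SimpleGraph.mem_neighborFinset] at hw ⊢
      exact hTG hw
    · simpa using hrb
    · rw [SimpleGraph.mem_neighborFinset]
      intro h
      have := hTH h
      simp [hHdef] at this
  have hdiv : ∀ v, ∑ c ∈ childSet par r v, x c / x (par c) =
      (∑ c ∈ childSet par r v, x c) / x v := by
    intro v
    rw [Finset.sum_div]
    exact Finset.sum_congr rfl fun c hc => by rw [(mem_childSet.1 hc).2]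
  refine ⟨par, r, _, fun v => x v / x (par v), hd,
    ⟨fun v => div_pos (hxpos _) (hxpos _), fun v hv => ?_, ?_⟩, hTG⟩
  · have := hle v
    rw [if_neg hv] at this
    simp only [hdiv, inv_div]
    rw [← add_div, div_le_iff₀ (hxpos v)]
    exact this
  · simp only [hdiv]
    rw [div_lt_iff₀ (hxpos r)]
    exact hlt

/-- If no vertex has two children, the tree is a path, and its dissociation number is at most
`(2 n + 2) / 3`. For a dissociation set with complement `T`, each vertex is the root, a child of
the root, in `T`, a child of a vertex of `T`, or a grandchild of one; so `n ≤ 2 + 3 |T|`. -/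
theorem three_mul_dissociationNumber_le {par : V → V} {r : V} {d : V → ℕ} (hd : IsRank par r d)
    (hinj : ∀ a b, a ≠ r → b ≠ r → par a = par b → a = b) :
    3 * dissociationNumber (parentGraph par r) ≤ 2 * Fintype.card V + 2 := by
  obtain ⟨S, hS, hcard⟩ := exists_isDissociationSet_card_eq (parentGraph par r)
  rw [isDissociationSet_iff] at hS
  let ch : Finset V → Finset V := fun X => Finset.univ.filter fun c => c ≠ r ∧ par c ∈ X
  have hch : ∀ X, (ch X).card ≤ X.card := by
    intro X
    refine Finset.card_le_card_of_injOn par (fun c hc => ?_) fun a ha b hb h => ?_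
    · simp only [ch, Finset.coe_filter, Set.mem_ofPred_eq] at hc
      exact hc.2.2
    · simp only [ch, Finset.coe_filter, Set.mem_ofPred_eq] at ha hb
      exact hinj a b ha.2.1 hb.2.1 h
  have hcover : (Finset.univ : Finset V) ⊆ ({r} ∪ ch {r}) ∪ (Sᶜ ∪ ch Sᶜ ∪ ch (ch Sᶜ)) := by
    intro v _
    by_contra hv
    simp only [ch, Finset.mem_union, Finset.mem_singleton, Finset.mem_compl, Finset.mem_filter,
      Finset.mem_univ, true_and, not_or, not_and, not_not] at hv
    obtain ⟨⟨hvr, hpr⟩, ⟨hvS, hpS⟩, hppS⟩ := hv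
    have hpr := hpr hvr
    have h := hS (par v) (hpS hvr) v hvS (par (par v)) (hppS hvr hpr)
      (hd.parentGraph_adj.2 (Or.inr ⟨hvr, rfl⟩)) (hd.parentGraph_adj.2 (Or.inl ⟨hpr, rfl⟩))
    have h1 := hd v hvr
    have h2 := hd _ hpr
    rw [← h] at h2
    omega
  have h1 := Finset.card_le_card hcover
  have h2 := Finset.card_union_le ({r} ∪ ch {r}) (Sᶜ ∪ ch Sᶜ ∪ ch (ch Sᶜ))
  have h3 := Finset.card_union_le {r} (ch {r})
  have h4 := Finset.card_union_le (Sᶜ ∪ ch Sᶜ) (ch (ch Sᶜ))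
  have h5 := Finset.card_union_le Sᶜ (ch Sᶜ)
  have h6 := hch {r}
  have h7 := hch Sᶜ
  have h8 := hch (ch Sᶜ)
  have h9 := Finset.card_compl S
  have h10 := Finset.card_le_univ S
  rw [Finset.card_univ] at h1
  rw [Finset.card_singleton] at h3 h6
  omega

end ParentFunctions

/-! ### Moving branches -/

section MovingBranches

variable {V : Type*} [Fintype V] [DecidableEq V]

/-- Where every vertex has at most one child, the ratios may be truncated at one: this is where
`2 ≤ lam` enters. -/
theorem RatioCertificate.exists_le_one {par : V → V} {r : V} {d : V → ℕ} {lam : ℝ} {g : V → ℝ}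
    (hd : IsRank par r d) (hg : RatioCertificate par r lam g) (hlam : 2 ≤ lam) {D : ℕ}
    (hD : ∀ v, D < d v → (childSet par r v).card ≤ 1) :
    ∃ g', RatioCertificate par r lam g' ∧ ∀ v, v ≠ r → D < d v → g' v ≤ 1 := by
  let g' : V → ℝ := fun v => if D < d v then min (g v) 1 else g v
  have hle : ∀ v, g' v ≤ g v := fun v => by
    simp only [g']
    split_ifs
    · exact min_le_left _ _
    · exact le_rfl
  have hle1 : ∀ v, D < d v → g' v ≤ 1 := fun v hv => by
    simp only [g', if_pos hv]
    exact min_le_right _ _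
  have hsum : ∀ v, ∑ c ∈ childSet par r v, g' c ≤ ∑ c ∈ childSet par r v, g c := fun v =>
    Finset.sum_le_sum fun c _ => hle c
  refine ⟨g', ⟨fun v => ?_, fun v hvr => ?_, (hsum r).trans_lt hg.root⟩, fun v _ => hle1 v⟩
  · simp only [g']
    split_ifs
    · exact lt_min (hg.pos v) one_pos
    · exact hg.pos v
  · by_cases h : D < d v ∧ 1 < g v
    · have hv1 : g' v = 1 := by
        simp only [g', if_pos h.1]
        exact min_eq_right h.2.le
      have hchild : ∑ c ∈ childSet par r v, g' c ≤ (childSet par r v).card • (1 : ℝ) := by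
        refine Finset.sum_le_card_nsmul _ _ _ fun c hc => hle1 c ?_
        obtain ⟨hcr, rfl⟩ := mem_childSet.1 hc
        exact h.1.trans (hd c hcr)
      have hc : ((childSet par r v).card : ℝ) ≤ 1 := by exact_mod_cast hD v h.1
      rw [hv1, inv_one]
      rw [nsmul_eq_mul, mul_one] at hchild
      linarith
    · have hv : g' v = g v := by
        simp only [g']
        split_ifs with h'
        · exact min_eq_left (not_lt.1 fun h1 => h ⟨h', h1⟩)
        · rfl
      rw [hv]
      linarith [hg.nonroot v hvr, hsum v]

/-- The map `t ↦ (lam - t)⁻¹` does not expand distances on `t ≤ 1`, as `lam - t ≥ 1` there.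
Here `a` and `w` are the old ratios of a child and its parent, and `b` is the new ratio of the
child. -/
theorem inv_sub_le_add {lam a b q w : ℝ} (hlam : 2 ≤ lam) (hb : b ≤ 1) (hq : 0 ≤ q)
    (hab : b ≤ a + q) (hw : 0 < w) (h : a + w⁻¹ ≤ lam) : (lam - b)⁻¹ ≤ w + q := by
  have hwa : 1 ≤ w * (lam - a) := by
    have := mul_le_mul_of_nonneg_left (by linarith : w⁻¹ ≤ lam - a) hw.le
    rwa [mul_inv_cancel₀ hw.ne'] at this
  rw [inv_le_iff_one_le_mul₀ (by linarith)]
  have hqb : q ≤ q * (lam - b) := le_mul_of_one_le_right hq (by linarith)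
  have hwb : w ≤ w * (lam - b) := le_mul_of_one_le_right hw.le (by linarith)
  rcases le_or_gt w 1 with hw1 | hw1
  · have : w * (b - a) ≤ q := by
      rcases le_or_gt b a with hba | hba
      · nlinarith
      · nlinarith
    nlinarith
  · nlinarith

/-- Below `w` the tree is a chain ending in a leaf `z`. Hanging a branch of ratio `q ≤ 1` at `z`
requires new ratios `g'` along the chain `C` from `w` to `z`, and increases the ratio of `w` by at
most `q`. -/
theorem RatioCertificate.exists_chain {par : V → V} {r : V} {d : V → ℕ} {lam : ℝ} {g : V → ℝ}
    (hd : IsRank par r d) (hg : RatioCertificate par r lam g) (hlam : 2 ≤ lam) {D : ℕ}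
    (hD : ∀ v, D < d v → (childSet par r v).card ≤ 1) {q : ℝ} (hq : 0 < q) (hq1 : q ≤ 1)
    (w : V) (hwr : w ≠ r) (hw : D < d w) :
    ∃ (z : V) (C : Finset V) (g' : V → ℝ), w ∈ C ∧ z ∈ C ∧ childSet par r z = ∅ ∧
      (∀ v ∈ C, v ≠ r ∧ d w ≤ d v ∧ (v ≠ w → par v ∈ C)) ∧
      (∀ v, v ∉ C → g' v = g v) ∧
      (∀ v ∈ C, 0 < g' v ∧ g' v ≤ 1 ∧
        ∑ c ∈ childSet par r v, g' c + (if v = z then q else 0) + (g' v)⁻¹ ≤ lam) ∧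
      g' w ≤ g w + q := by
  obtain ⟨N, hN⟩ : ∃ N, ∀ v, d v ≤ N := 
    ⟨Finset.univ.sup d, fun v => Finset.le_sup (Finset.mem_univ v)⟩
  induction hm : N - d w using Nat.strong_induction_on generalizing w with
  | _ m ih =>
    have hnon := hg.nonroot w hwr
    rcases (childSet par r w).eq_empty_or_nonempty with hE | ⟨c, hc⟩
    · refine ⟨w, {w}, Function.update g w (lam - q)⁻¹, by simp, by simp, hE, ?_, ?_, ?_, ?_⟩
      · simp [hwr]
      · intro v hv
        rw [Function.update_of_ne (by simpa using hv)]
      · intro v hv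
        obtain rfl := Finset.mem_singleton.1 hv
        rw [Function.update_self, hE]
        refine ⟨inv_pos.2 (by linarith), inv_le_one_of_one_le₀ (by linarith), ?_⟩
        simp
      · rw [Function.update_self]
        rw [hE, Finset.sum_empty] at hnon
        exact inv_sub_le_add hlam hq1 hq.le (by simp) (hg.pos w) hnon
    · have hcs : childSet par r w = {c} :=
        (Finset.card_eq_one.1 (le_antisymm (hD w hw) (Finset.card_pos.2 ⟨c, hc⟩))).elim
          fun c' h => by
            rw [h] at hc ⊢
            rw [Finset.mem_singleton.1 hc]
      obtain ⟨hcr, hcw⟩ := mem_childSet.1 hc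
      have hdc := hd c hcr
      rw [hcw] at hdc
      obtain ⟨z, C, g', hcC, hzC, hz, hC, hoff, hon, hgc⟩ :=
        ih (N - d c) (by have := hN c; omega) c hcr (hw.trans hdc) rfl
      have hwC : w ∉ C := fun h => by
        have := (hC w h).2.1
        omega
      have hb := (hon c hcC).2.1
      rw [hcs, Finset.sum_singleton] at hnon
      refine ⟨z, insert w C, Function.update g' w (lam - g' c)⁻¹, Finset.mem_insert_self _ _,
        Finset.mem_insert_of_mem hzC, hz, ?_, ?_, ?_, ?_⟩
      · intro v hv
        rcases Finset.mem_insert.1 hv with rfl | hv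
        · exact ⟨hwr, le_rfl, fun h => absurd rfl h⟩
        · obtain ⟨h1, h2, h3⟩ := hC v hv
          refine ⟨h1, hdc.le.trans h2, fun _ => ?_⟩
          by_cases hvc : v = c
          · rw [hvc, hcw]
            exact Finset.mem_insert_self _ _
          · exact Finset.mem_insert_of_mem (h3 hvc)
      · intro v hv
        rw [Finset.mem_insert, not_or] at hv
        rw [Function.update_of_ne hv.1, hoff v hv.2]
      · intro v hv
        rcases Finset.mem_insert.1 hv with rfl | hvC
        · have hvz : v ≠ z := fun h => hwC (h ▸ hzC)
          have hcv : c ≠ v := fun h => hwC (h ▸ hcC)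
          rw [hcs, Finset.sum_singleton, Function.update_self, Function.update_of_ne hcv,
            if_neg hvz]
          refine ⟨inv_pos.2 (by linarith), inv_le_one_of_one_le₀ (by linarith), ?_⟩
          simp
        · have hvw : v ≠ w := fun h => hwC (h ▸ hvC)
          rw [Function.update_of_ne hvw]
          convert hon v hvC using 5
          refine Finset.sum_congr rfl fun c' hc' => Function.update_of_ne ?_ _ _
          rintro rfl
          obtain ⟨h1, h2⟩ := mem_childSet.1 hc'
          have h3 := hd _ h1
          rw [h2] at h3
          have := (hC v hvC).2.1
          omega
      · rw [Function.update_self]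
        exact inv_sub_le_add hlam hb hq.le hgc (hg.pos w) hnon

theorem childSet_update {par : V → V} {r c z v : V} (hc : c ≠ r) :
    childSet (Function.update par c z) r v =
      if v = z then insert c (childSet par r v) else (childSet par r v).erase c := by
  ext a
  by_cases hac : a = c
  · subst hac
    split_ifs with h <;> simp [hc, eq_comm (a := z), h]
  · split_ifs with h <;> simp [hac]

/-- If some vertex has two children, a branch can be moved so that the tree keeps its
certificate, changes only in edges at one vertex, and has one leaf less (one more vertex is a
parent). At a branching vertex `u` of greatest rank, with children `c₁` and `c₂`, everything below
is a chain; the branch at `c₂` is hung at the end of the chain from `c₁`. The sum over the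
children of `u` loses `g c₂`, and the ratio at `c₁` increases by at most that. -/
theorem RatioCertificate.exists_move {par : V → V} {r : V} {d : V → ℕ} {lam : ℝ} {g : V → ℝ}
    (hd : IsRank par r d) (hg : RatioCertificate par r lam g) (hlam : 2 ≤ lam)
    (hbranch : ∃ a b, a ≠ r ∧ b ≠ r ∧ par a = par b ∧ a ≠ b) :
    ∃ (par' : V → V) (d' : V → ℕ) (g' : V → ℝ) (w : V), IsRank par' r d' ∧
      RatioCertificate par' r lam g' ∧ (∀ v, v ≠ w → par' v = par v) ∧
      ((Finset.univ.erase r).image par).card < ((Finset.univ.erase r).image par').card := by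
  obtain ⟨u, hu, hmax⟩ := Finset.exists_max_image
    (Finset.univ.filter fun v => 1 < (childSet par r v).card) d (by
      obtain ⟨a, b, ha, hb, hab, hne⟩ := hbranch
      exact ⟨par a, by simpa using Finset.one_lt_card.2 ⟨a, by simp [ha], b, by simp [hb, hab], hne⟩⟩)
  have hD : ∀ v, d u < d v → (childSet par r v).card ≤ 1 := by
    intro v hv
    by_contra! h
    have := hmax v (by simpa using h)
    omega
  simp only [Finset.mem_filter, Finset.mem_univ, true_and] at hu
  obtain ⟨c₁, hc₁, c₂, hc₂, hne⟩ := Finset.one_lt_card.1 hu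
  obtain ⟨h1r, h1u⟩ := mem_childSet.1 hc₁
  obtain ⟨h2r, h2u⟩ := mem_childSet.1 hc₂
  have hd1 : d u < d c₁ := h1u ▸ hd c₁ h1r
  have hd2 : d u < d c₂ := h2u ▸ hd c₂ h2r
  obtain ⟨g, hg, hg1⟩ := hg.exists_le_one hd hlam hD
  obtain ⟨z, C, g', h1C, hzC, hz, hC, hoff, hon, hgc⟩ :=
    hg.exists_chain hd hlam hD (hg.pos c₂) (hg1 c₂ h2r hd2) c₁ h1r hd1
  have huC : u ∉ C := fun h => by
    have := (hC u h).2.1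
    omega
  have hparC : ∀ v ∈ C, v ≠ c₁ → par v ∈ C := fun v hv => (hC v hv).2.2
  have h2C : c₂ ∉ C := fun h => huC (h2u ▸ hparC c₂ h hne.symm)
  have huz : u ≠ z := fun h => huC (h ▸ hzC)
  have hrC : r ∉ C := fun h => (hC r h).1 rfl
  have hrz : r ≠ z := fun h => hrC (h ▸ hzC)
  -- Outside the chain nothing changes except at `u`.
  have hsum : ∀ v, v ∉ C → ∑ c ∈ (childSet par r v).erase c₂, g' c ≤
      ∑ c ∈ childSet par r v, g c := by
    intro v hv
    have hsame : ∀ c ∈ childSet par r v, c ≠ c₁ → g' c = g c := fun c hc hc1 =>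
      hoff c fun hcC => hv ((mem_childSet.1 hc).2 ▸ hparC c hcC hc1)
    by_cases hvu : v = u
    · subst hvu
      have h1 : c₁ ∈ (childSet par r v).erase c₂ := Finset.mem_erase.2 ⟨hne, hc₁⟩
      rw [← Finset.add_sum_erase _ _ hc₂, ← Finset.add_sum_erase _ _ h1,
        ← Finset.add_sum_erase _ g h1]
      have : ∑ c ∈ ((childSet par r v).erase c₂).erase c₁, g' c =
          ∑ c ∈ ((childSet par r v).erase c₂).erase c₁, g c :=
        Finset.sum_congr rfl fun c hc => hsame c
          (Finset.mem_of_mem_erase (Finset.mem_of_mem_erase hc)) (Finset.ne_of_mem_erase hc)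
      linarith
    · rw [Finset.erase_eq_of_notMem fun h => hvu ((mem_childSet.1 h).2.symm.trans h2u)]
      refine (Finset.sum_congr rfl fun c hc => hsame c hc ?_).le
      rintro rfl
      exact hvu ((mem_childSet.1 hc).2.symm.trans h1u)
  -- The vertices outside the chain of rank greater than that of `u` are raised above `z`, so that
  -- `z` may become the parent of `c₂`.
  refine ⟨Function.update par c₂ z, fun v => if d u < d v ∧ v ∉ C then d v + d z else d v, g', c₂,
    fun v hv => ?_, ⟨fun v => ?_, fun v hv => ?_, ?_⟩,
    fun v hv => Function.update_of_ne hv _ _, ?_⟩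
  · by_cases hv2 : v = c₂
    · subst hv2
      rw [Function.update_self]
      simp only [hzC, not_true_eq_false, and_false, if_false, hd2, h2C, not_false_eq_true, and_true,
        if_true]
      omega
    · rw [Function.update_of_ne hv2]
      have hlt := hd v hv
      by_cases hvC : v ∈ C
      · have hp : ¬ (d u < d (par v) ∧ par v ∉ C) := by
          rintro ⟨h1, h2⟩
          by_cases hv1 : v = c₁
          · rw [hv1, h1u] at h1
            exact lt_irrefl _ h1
          · exact h2 (hparC v hvC hv1)
        simp only [hp, if_false, hvC, not_true_eq_false, and_false]
        exact hlt
      · simp only [hvC, not_false_eq_true, and_true]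
        split_ifs <;> omega
  · by_cases hvC : v ∈ C
    · exact (hon v hvC).1
    · rw [hoff v hvC]
      exact hg.pos v
  · rw [childSet_update h2r]
    by_cases hvC : v ∈ C
    · have h := (hon v hvC).2.2
      have h2v : c₂ ∉ childSet par r v := fun h => huC (by
        rw [← h2u, (mem_childSet.1 h).2]
        exact hvC)
      split_ifs with hvz
      · rw [if_pos hvz] at h
        rw [Finset.sum_insert h2v, hoff c₂ h2C]
        linarith
      · rw [if_neg hvz, add_zero] at h
        rwa [Finset.erase_eq_of_notMem h2v]
    · rw [if_neg fun h : v = z => hvC (h ▸ hzC), hoff v hvC]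
      linarith [hsum v hvC, hg.nonroot v hv]
  · rw [childSet_update h2r, if_neg hrz]
    exact (hsum r hrC).trans_lt hg.root
  · refine Finset.card_lt_card ⟨fun p hp => ?_, fun hsub => ?_⟩
    · obtain ⟨v, hv, rfl⟩ := Finset.mem_image.1 hp
      by_cases hv2 : v = c₂
      · refine Finset.mem_image.2 ⟨c₁, by simpa using h1r, ?_⟩
        rw [Function.update_of_ne hne, h1u, hv2, h2u]
      · exact Finset.mem_image.2 ⟨v, hv, Function.update_of_ne hv2 _ _⟩
    · have hzi : z ∈ (Finset.univ.erase r).image (Function.update par c₂ z) :=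
        Finset.mem_image.2 ⟨c₂, by simpa using h2r, Function.update_self _ _ _⟩
      obtain ⟨v, hv, hvz⟩ := Finset.mem_image.1 (hsub hzi)
      have : v ∈ childSet par r z := mem_childSet.2 ⟨Finset.ne_of_mem_erase hv, hvz⟩
      rw [hz] at this
      exact absurd this (Finset.notMem_empty v)

/-- Discrete continuity: moving branches until the tree is a path lowers the dissociation number
by at most one at a time, so it takes every value from that of the path up. -/
theorem RatioCertificate.exists_dissociationNumber_eq {r : V} {lam : ℝ} (hlam : 2 ≤ lam) {k : ℕ}
    (hk : 2 * Fintype.card V + 2 < 3 * k) (par : V → V) {d : V → ℕ} {g : V → ℝ}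
    (hd : IsRank par r d) (hg : RatioCertificate par r lam g)
    (hpar : k ≤ dissociationNumber (parentGraph par r)) :
    ∃ (par' : V → V) (d' : V → ℕ) (g' : V → ℝ), IsRank par' r d' ∧
      RatioCertificate par' r lam g' ∧ dissociationNumber (parentGraph par' r) = k := by
  induction hm : Fintype.card V - ((Finset.univ.erase r).image par).card
    using Nat.strong_induction_on generalizing par d g with
  | _ m ih =>
    by_cases heq : dissociationNumber (parentGraph par r) = k
    · exact ⟨par, d, g, hd, hg, heq⟩
    by_cases hbranch : ∃ a b, a ≠ r ∧ b ≠ r ∧ par a = par b ∧ a ≠ b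
    · obtain ⟨par', d', g', w, hd', hg', hsame, hcard⟩ := hg.exists_move hd hlam hbranch
      have hle := dissociationNumber_le_add_one (G := parentGraph par r) (H := parentGraph par' r) w
        fun a b ha hb hab => by
          rw [hd'.parentGraph_adj, hsame a ha, hsame b hb] at hab
          exact hd.parentGraph_adj.2 hab
      have := Finset.card_le_univ ((Finset.univ.erase r).image par')
      exact ih _ (by omega) par' hd' hg' (by omega) rfl
    · push Not at hbranch
      have := three_mul_dissociationNumber_le hd hbranch
      omega

end MovingBranches

/-! ### Minimizers are trees -/

theorem theorem1p1 {V : Type*} [Fintype V] (n k : ℕ) (hk : ⌈(2 * (n : ℚ)) / 3⌉₊ < k)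
    (G : SimpleGraph V) (hG : AttainsMinSpectralRadius n k G) : G.IsTree := by
  classical
  obtain ⟨⟨hn, hconn, hdiss⟩, hmin⟩ := hG
  by_contra hT
  have : Nonempty V := hconn.nonempty
  have hk' : 2 * Fintype.card V + 2 < 3 * k := by
    have h := Nat.ceil_le.1 (Nat.le_sub_one_of_lt hk)
    have h1 : 1 ≤ k := by omega
    rw [Nat.cast_sub h1, div_le_iff₀ (by norm_num)] at h
    have h2 : 2 * n ≤ (k - 1) * 3 := by
      have : ((2 * n : ℕ) : ℚ) ≤ ((k - 1) * 3 : ℕ) := by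
        rw [Nat.cast_mul, Nat.cast_mul, Nat.cast_sub h1]
        exact_mod_cast h
      exact_mod_cast this
    omega
  obtain ⟨par, r, d, g, hd, hg, hle⟩ := exists_ratioCertificate_of_not_isTree hconn hT
  obtain ⟨par', d', g', hd', hg', heq⟩ :=
    RatioCertificate.exists_dissociationNumber_eq (hconn.two_le_graphSpectralRadius hT) hk' par
      hd hg (hdiss ▸ dissociationNumber_anti hle)
  exact (hmin _ ⟨hn, hd'.connected, heq⟩).not_gt (hg'.graphSpectralRadius_lt hd')
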